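/- Let $d\ge 1$, let $\mathbb D$ be the open unit disk, $\mathbb T$ the unit circle, and let $\mathcal H_d$ be the set of holomorphic functions $\mathbb D^d\to\overline{\mathbb D}$ with the topology of uniform convergence on compact sets. For $r\in\overline{\mathbb D}$ and $1\le j\le d$ define operators on $\mathcal H_d$ by $(\mathfrak m_jh)(z)=z_jh(z)$ and $\mathfrak g_rh=\dfrac{h+r}{1+\bar r h}$ if $|r|<1$, $\mathfrak g_rh\equiv r$ if $|r|=1$. Let $\mathcal S_d$ (the Schur functions) be the closure in $\mathcal H_d$ of the orbit of the zero function under the semigroup generated by all $\mathfrak g_r\mathfrak m_j$ with $|r|<1$, $1\le j\le d$. A continued fraction expansion of $f\in\mathcal S_d$ consists of $r_n\in\overline{\mathbb D}$ $(n\ge0)$ (the Schur parameters), $\nu_n\in\{1,\dots,d\}$ $(n\ge1)$ and $h_n\in\mathcal S_d$ $(n\ge0)$ such that $h_0=f$, $r_n=h_n(0)$ and $h_n=\mathfrak g_{r_n}\mathfrak m_{\nu_{n+1}}h_{n+1}$ for all $n\ge0$, where $\nu_{n+1}=1$ and $h_{n+1}=0$ whenever $h_n$ is constant. Its convergents are $f_n=\mathfrak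 g_{r_0}\mathfrak m_{\nu_1}\mathfrak g_{r_1}\cdots\mathfrak m_{\nu_n}\mathfrak g_{r_n}0$. The function $f\in\mathcal S_d$ is standard if $f(0)=0$ and all its Schur parameters satisfy $|r_n|<1$. For $g\in\mathcal H_d$ with $g(0)=0$, let $\mu_g$ be the probability measure on $\mathbb T^d$ determined by $$\operatorname{Re}\frac{1+g(z)}{1-g(z)}=\int_{\mathbb T^d}\prod_{j=1}^d\frac{1-|z_j|^2}{|\zeta_j-z_j|^2}\,d\mu_g(\zeta)\qquad(z\in\mathbb D^d).$$ Let $f\in\mathcal S_d$ be standard, with a continued fraction expansion given by $r,\nu,h$ and convergents $f_n$. Put $$M_0=\begin{pmatrix}1&1\\-1&1\end{pmatrix},\qquad M_n=\begin{pmatrix}z_{\nu_n}&r_nz_{\nu_n}\\ \overline{r_n}&1\end{pmatrix}\quad(n\ge1),$$ and let $\Phi_n\in\mathbb C[z_1,\dots,z_d]$ be the negative of the lower left entry of $M_0M_1\cdots M_n$ $(n\ge 0)$. Then the measures $\mu_f$ and $\mu_{f_n}$ exist and are unique, $\mu_{f_n}\to\mu_f$ weakly as $n\to\infty$, and the polynomials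 $\Phi_n$ are orthogonal on $\mathbb T^d$ with respect to $\mu_f$; more precisely, for all integers $j,k\ge0$, $$\int_{\mathbb T^d}\Phi_j\overline{\Phi_k}\,d\mu_f=\begin{cases}0&\text{if }j\ne k,\\ \prod_{s=1}^j(1-|r_s|^2)&\text{if }j=k.\end{cases}$$ -/

import Mathlib

open Filter Topology MeasureTheory
open scoped ComplexConjugate

noncomputable section

namespace SchurTorus

/-- The open unit polydisc `𝔻^d`, as a subtype of `ℂ^d`. -/
abbrev Polydisc (d : ℕ) : Type := {z : Fin d → ℂ // ∀ j, ‖z j‖ < 1}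

/-- The centre of the polydisc. -/
def origin (d : ℕ) : Polydisc d := ⟨0, fun _ => by simp⟩

/-- A function on the polydisc is holomorphic with values in the closed unit disc. -/
def IsDiscHolomorphic {d : ℕ} (h : Polydisc d → ℂ) : Prop :=
  (∃ F : (Fin d → ℂ) → ℂ, DifferentiableOn ℂ F {z | ∀ j, ‖z j‖ < 1} ∧
    ∀ z : Polydisc d, h z = F z) ∧
  ∀ z, ‖h z‖ ≤ 1

/-- The space `ℋ_d` of holomorphic functions from `𝔻^d` to the closed unit disc. As a subtype of
the space of continuous functions with its compact-open topology, it carries the topology of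
uniform convergence on compact sets. -/
abbrev HolSpace (d : ℕ) : Type := {h : C(Polydisc d, ℂ) // IsDiscHolomorphic h}

theorem IsDiscHolomorphic.continuous {d : ℕ} {h : Polydisc d → ℂ} (hh : IsDiscHolomorphic h) :
    Continuous h := by
  obtain ⟨⟨F, hF, hFh⟩, -⟩ := hh
  have h1 : Continuous (Set.domRestrict {z : Fin d → ℂ | ∀ j, ‖z j‖ < 1} F) :=
    continuousOn_iff_continuous_domRestrict.mp hF.continuousOn
  have h2 : h = Set.domRestrict {z : Fin d → ℂ | ∀ j, ‖z j‖ < 1} F := funext hFh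
  rw [h2]
  exact h1

/-- The element of `ℋ_d` given by a holomorphic function into the closed unit disc. -/
def HolSpace.mk {d : ℕ} (h : Polydisc d → ℂ) (hh : IsDiscHolomorphic h) : HolSpace d :=
  ⟨⟨h, hh.continuous⟩, hh⟩

/-- The constant function with value `r` in the closed unit disc. -/
def constFun (d : ℕ) (r : Complex.UnitClosedDisc) : HolSpace d :=
  HolSpace.mk (fun _ => (r : ℂ))
    ⟨⟨fun _ => (r : ℂ), differentiableOn_const _, fun _ => rfl⟩, fun _ => r.norm_le_one⟩

/-- The map `ξ ↦ (ξ + r) / (1 + r̄ ξ)` on the closed unit disc, which is the constant `r` when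
`r` lies on the unit circle. -/
def discMap (r ξ : ℂ) : ℂ := if ‖r‖ < 1 then (ξ + r) / (1 + conj r * ξ) else r

theorem one_add_conj_mul_ne_zero {r ξ : ℂ} (hr : ‖r‖ < 1) (hx : ‖ξ‖ ≤ 1) :
    1 + conj r * ξ ≠ 0 := by
  intro h
  have h1 : ‖conj r * ξ‖ = 1 := by
    rw [show conj r * ξ = -1 by linear_combination h]; simp
  rw [norm_mul, RCLike.norm_conj] at h1
  nlinarith [norm_nonneg r, norm_nonneg ξ]

theorem norm_discMap_le_one {r ξ : ℂ} (hr : ‖r‖ ≤ 1) (hx : ‖ξ‖ ≤ 1) : ‖discMap r ξ‖ ≤ 1 := by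
  unfold discMap
  split_ifs with h
  · rw [norm_div]
    refine div_le_one_of_le₀ ?_ (norm_nonneg _)
    have key : Complex.normSq (1 + conj r * ξ) - Complex.normSq (ξ + r)
        = (1 - Complex.normSq r) * (1 - Complex.normSq ξ) := by
      simp only [Complex.normSq_apply, Complex.add_re, Complex.add_im, Complex.mul_re,
        Complex.mul_im, Complex.conj_re, Complex.conj_im, Complex.one_re, Complex.one_im]
      ring
    simp only [Complex.normSq_eq_norm_sq] at key
    have h1 : 0 ≤ 1 - ‖r‖ ^ 2 := by nlinarith [norm_nonneg r]
    have h2 : 0 ≤ 1 - ‖ξ‖ ^ 2 := by nlinarith [norm_nonneg ξ]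
    exact le_of_sq_le_sq (by nlinarith [mul_nonneg h1 h2]) (norm_nonneg _)
  · exact hr

/-- The operator `𝔤_r : ℋ_d → ℋ_d` of composition with `ξ ↦ (ξ + r) / (1 + r̄ ξ)`. -/
def gOp {d : ℕ} (r : Complex.UnitClosedDisc) (h : HolSpace d) : HolSpace d :=
  HolSpace.mk (fun z => discMap (r : ℂ) (h.1 z)) <| by
    obtain ⟨⟨F, hF, hFh⟩, hb⟩ := h.2
    refine ⟨⟨fun z => discMap (r : ℂ) (F z), ?_, fun z => by simp only [hFh z]⟩,
      fun z => norm_discMap_le_one r.norm_le_one (hb z)⟩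
    by_cases hr : ‖(r : ℂ)‖ < 1
    · simp only [discMap, if_pos hr, div_eq_mul_inv]
      refine (hF.add_const _).mul (DifferentiableOn.inv
        (DifferentiableOn.const_add _ (hF.const_mul _)) fun z hz => ?_)
      refine one_add_conj_mul_ne_zero hr ?_
      have := hb ⟨z, hz⟩
      rwa [hFh ⟨z, hz⟩] at this
    · simp only [discMap, if_neg hr]
      exact differentiableOn_const _

/-- The operator `𝔪_j : ℋ_d → ℋ_d` of multiplication by the `j`-th coordinate. -/
def mOp {d : ℕ} (j : Fin d) (h : HolSpace d) : HolSpace d :=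
  HolSpace.mk (fun z => z.1 j * h.1 z) <| by
    obtain ⟨⟨F, hF, hFh⟩, hb⟩ := h.2
    refine ⟨⟨fun z => z j * F z, ?_, fun z => by simp only [hFh z]⟩, fun z => ?_⟩
    · exact (differentiable_apply j).differentiableOn.mul hF
    · rw [norm_mul]
      exact mul_le_one₀ (z.2 j).le (norm_nonneg _) (hb z)

/-- The semigroup (under composition) of operators on `ℋ_d` generated by the products `𝔤_r 𝔪_j`
with `|r| < 1`. -/
def opSemigroup (d : ℕ) : Subsemigroup (Function.End (HolSpace d)) :=
  Subsemigroup.closure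
    {T | ∃ (r : Complex.UnitClosedDisc) (j : Fin d), ‖(r : ℂ)‖ < 1 ∧ T = fun h => gOp r (mOp j h)}

/-- The set `𝒮_d` of Schur functions: the closure in `ℋ_d` of the orbit of the zero function. -/
def schurSet (d : ℕ) : Set (HolSpace d) :=
  closure {f | ∃ T ∈ opSemigroup d, f = T (constFun d 0)}

/-- `r`, `ν`, `h` are the Schur parameters, the variable allocation map and the successive remainders
in a continued fraction expansion of `f`. The value `ν 0` is not used; the variables `z_1, …, z_d`
are indexed from `0`, so that `(0 : Fin d)` is the first one. -/
structure IsExpansion {d : ℕ} [NeZero d] (f : HolSpace d) (r : ℕ → Complex.UnitClosedDisc)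
    (ν : ℕ → Fin d) (h : ℕ → HolSpace d) : Prop where
  start : h 0 = f
  mem : ∀ n, h n ∈ schurSet d
  param : ∀ n, (r n : ℂ) = (h n).1 (origin d)
  step : ∀ n, h n = gOp (r n) (mOp (ν (n + 1)) (h (n + 1)))
  const : ∀ n, (∃ c, ∀ z, (h n).1 z = c) → ν (n + 1) = 0 ∧ h (n + 1) = constFun d 0

/-- A Schur function is standard if it vanishes at the origin and its Schur parameters all have
modulus less than one. -/
def IsStandard {d : ℕ} [NeZero d] (f : HolSpace d) : Prop :=
  f ∈ schurSet d ∧ f.1 (origin d) = 0 ∧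
    ∀ r ν h, IsExpansion f r ν h → ∀ n, ‖(r n : ℂ)‖ < 1

/-- The operator `𝔤_{r_0} 𝔪_{ν_1} 𝔤_{r_1} ⋯ 𝔪_{ν_n} 𝔤_{r_n}`. -/
def convergentOp {d : ℕ} (r : ℕ → Complex.UnitClosedDisc) (ν : ℕ → Fin d) :
    ℕ → HolSpace d → HolSpace d
  | 0 => gOp (r 0)
  | n + 1 => fun h => convergentOp r ν n (mOp (ν (n + 1)) (gOp (r (n + 1)) h))

/-- The `n`-th convergent `f_n`. -/
def convergent {d : ℕ} (r : ℕ → Complex.UnitClosedDisc) (ν : ℕ → Fin d) (n : ℕ) : HolSpace d :=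
  convergentOp r ν n (constFun d 0)

/-- The Borel σ-algebra on the unit circle. -/
instance instMeasurableSpaceCircle : MeasurableSpace Circle := borel Circle

instance instBorelSpaceCircle : BorelSpace Circle := ⟨rfl⟩

/-- The torus `𝕋^d`. -/
abbrev Torus (d : ℕ) : Type := Fin d → Circle

/-- The Poisson kernel `K_z(ζ)` of the polydisc; for `z_j = s e^{iφ}` and `ζ_j = e^{iθ}` one has
`|ζ_j - z_j|² = 1 - 2 s cos(φ - θ) + s²`. -/
def poissonKernel {d : ℕ} (z : Polydisc d) (ζ : Torus d) : ℝ :=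
  ∏ j, (1 - ‖z.1 j‖ ^ 2) / ‖(ζ j : ℂ) - z.1 j‖ ^ 2

/-- `Re ((1 + f) / (1 - f))` is the Poisson integral of `μ`. -/
def IsDeterminedBy {d : ℕ} (μ : ProbabilityMeasure (Torus d)) (f : HolSpace d) : Prop :=
  ∀ z : Polydisc d, ((1 + f.1 z) / (1 - f.1 z)).re = ∫ ζ, poissonKernel z ζ ∂(μ : Measure (Torus d))

instance instNonemptyProbTorus (d : ℕ) : Nonempty (ProbabilityMeasure (Torus d)) :=
  ⟨⟨Measure.dirac 1, inferInstance⟩⟩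

/-- The probability measure `μ_f` on the torus determined by `f ∈ ℋ_d` with `f(0) = 0`. -/
def schurMeasure {d : ℕ} (f : HolSpace d) : ProbabilityMeasure (Torus d) :=
  Classical.epsilon fun μ => IsDeterminedBy μ f

/-- The matrices `M_n` (`n ≥ 0`) with polynomial entries. -/
def transferMatrix {d : ℕ} (r : ℕ → Complex.UnitClosedDisc) (ν : ℕ → Fin d) :
    ℕ → Matrix (Fin 2) (Fin 2) (MvPolynomial (Fin d) ℂ)
  | 0 => !![1, 1; -1, 1]
  | n + 1 =>
    !![MvPolynomial.X (ν (n + 1)),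
        MvPolynomial.C (r (n + 1) : ℂ) * MvPolynomial.X (ν (n + 1));
      MvPolynomial.C (conj (r (n + 1) : ℂ)), 1]

/-- The product `P_n = M_0 M_1 ⋯ M_n`. -/
def transferProduct {d : ℕ} (r : ℕ → Complex.UnitClosedDisc) (ν : ℕ → Fin d) :
    ℕ → Matrix (Fin 2) (Fin 2) (MvPolynomial (Fin d) ℂ)
  | 0 => transferMatrix r ν 0
  | n + 1 => transferProduct r ν n * transferMatrix r ν (n + 1)

/-- The polynomial `Φ_n`, where `-Φ_n` is the lower left entry of `P_n`. -/
def orthoPoly {d : ℕ} (r : ℕ → Complex.UnitClosedDisc) (ν : ℕ → Fin d) (n : ℕ) :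
    MvPolynomial (Fin d) ℂ :=
  -(transferProduct r ν n 1 0)

/-- The values of a polynomial on the torus. -/
def torusEval {d : ℕ} (p : MvPolynomial (Fin d) ℂ) (ζ : Torus d) : ℂ :=
  MvPolynomial.eval (fun j => (ζ j : ℂ)) p

end SchurTorus

end

open SchurTorus

/-! The Cayley transform `(1 + w) / (1 - w)` turns composition of the operators `𝔤_r` and `𝔪_j` into
multiplication of the matrices `M_n`. Thus `(1 + f_n) / (1 - f_n)` is a quotient `carath` of
polynomials with denominator `Φ_n^*`, the reverse of `Φ_n`. As `Φ_n^*` has no zeros on the closed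
polydisc, `carath` is holomorphic near it; the determinant and reversal identities give it real part
`weight r n / |Φ_n|²` on the torus (`carath_re_on_torus`). So `μ_{f_n}` has this Bernstein–Szegő
density with respect to Haar measure.

Under `μ_{f_n}`, the pairing of `Φ_j` with `Φ_n` for `j ≤ n` is the conjugate of the mean of a
holomorphic function, hence of its value at the origin (`phiInner_self_right`). Replacing `n` by `n
+ 1` changes `carath` by a holomorphic multiple of `z_{ν_1} ⋯ z_{ν_{n+1}}`, which the products `Φ_j
conj Φ_k` with `j, k ≤ n` do not see (`phiInner_succ`). All pairings are therefore stationary in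
`n`.

At a fixed point each coordinate factor contracts the pseudo-hyperbolic distance, so `f_n → f`
pointwise. The Poisson transform is a continuous injection of a compact space, hence a closed
embedding; it turns this into existence and uniqueness of `μ_f` and weak convergence, and the
stationary pairings pass to the limit. -/

noncomputable section

namespace SchurTorus

/-! ### Poisson integrals on the circle and the torus -/

/-- The normalised arc length on the unit circle. -/
def circleMeasure : Measure Circle :=
  (ENNReal.ofReal (2 * Real.pi))⁻¹ •
    (volume.restrict (Set.Ioc 0 (2 * Real.pi))).map Circle.exp

instance instIsProbabilityMeasureCircle : IsProbabilityMeasure circleMeasure := by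
  constructor
  rw [circleMeasure, Measure.smul_apply, Measure.map_apply Circle.exp.continuous.measurable
    MeasurableSet.univ]
  simp only [Set.preimage_univ, Measure.restrict_apply_univ, Real.volume_Ioc, sub_zero,
    smul_eq_mul]
  exact ENNReal.inv_mul_cancel (by simp [Real.pi_pos]) ENNReal.ofReal_ne_top

theorem integral_circleMeasure {g : ℂ → ℂ} (hg : Continuous fun ζ : Circle => g ζ) :
    ∫ ζ : Circle, g ζ ∂circleMeasure = Real.circleAverage g 0 1 := by
  rw [circleMeasure, integral_smul_measure, integral_map
    Circle.exp.continuous.measurable.aemeasurable hg.aestronglyMeasurable,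
    Real.circleAverage_def, intervalIntegral.integral_of_le (by positivity)]
  congr 1
  · rw [ENNReal.toReal_inv, ENNReal.toReal_ofReal (by positivity)]
  · simp [circleMap, Circle.coe_exp]

theorem circle_sub_ne_zero (ζ : Circle) {z : ℂ} (hz : ‖z‖ < 1) : (ζ : ℂ) - z ≠ 0 := by
  intro h
  rw [← sub_eq_zero.mp h, Circle.norm_coe] at hz
  exact lt_irrefl _ hz

theorem continuous_circle_coe : Continuous fun ζ : Circle => (ζ : ℂ) := by fun_prop

/-- The Poisson integral formula on the disc. -/
theorem integral_poisson_circle {g : ℂ → ℂ} (hg : ∀ w, ‖w‖ ≤ 1 → DifferentiableAt ℂ g w)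
    {z : ℂ} (hz : ‖z‖ < 1) :
    ∫ ζ : Circle, (((1 - ‖z‖ ^ 2) / ‖(ζ : ℂ) - z‖ ^ 2 : ℝ) : ℂ) * g ζ ∂circleMeasure = g z := by
  have hd : DiffContOnCl ℂ g (Metric.ball 0 1) := by
    apply DifferentiableOn.diffContOnCl
    intro w hw
    rw [closure_ball _ one_ne_zero] at hw
    exact (hg w (by simpa using hw)).differentiableWithinAt
  have h := hd.circleAverage_poissonKernel_smul' (w := z) (by simpa using hz)
  rw [← h, ← integral_circleMeasure]
  · refine integral_congr_ae (.of_forall fun ζ => ?_)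
    simp [Circle.norm_coe]
  · have hgc : Continuous fun ζ : Circle => g ζ := continuous_iff_continuousAt.mpr fun ζ =>
      ContinuousAt.comp (g := g)
        (hg ζ (Circle.norm_coe ζ).le).continuousAt continuous_circle_coe.continuousAt
    have hc := continuous_circle_coe
    have hden : ∀ ζ : Circle, ‖(ζ : ℂ) - 0 - (z - 0)‖ ^ 2 ≠ 0 := fun ζ => by
      simpa using circle_sub_ne_zero ζ hz
    exact Continuous.smul (f := fun ζ : Circle =>
      (‖(ζ : ℂ) - 0‖ ^ 2 - ‖z - 0‖ ^ 2) / ‖(ζ : ℂ) - 0 - (z - 0)‖ ^ 2)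
      (Continuous.div (by fun_prop) (by fun_prop) hden) hgc

/-- The normalised Haar measure on the torus. -/
def torusHaar (d : ℕ) : Measure (Torus d) := Measure.pi fun _ => circleMeasure

instance instIsProbabilityMeasureTorusHaar (d : ℕ) : IsProbabilityMeasure (torusHaar d) := by
  unfold torusHaar; infer_instance

/-- The inclusion of the torus in `ℂ^d`. -/
def torusIncl {d : ℕ} (ζ : Torus d) : Fin d → ℂ := fun j => ζ j

theorem norm_torusIncl_le {d : ℕ} (ζ : Torus d) (j : Fin d) : ‖torusIncl ζ j‖ ≤ 1 := by
  simp [torusIncl, Circle.norm_coe]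

theorem continuous_torusIncl {d : ℕ} : Continuous (torusIncl (d := d)) := by
  unfold torusIncl; fun_prop

theorem continuous_comp_torusIncl {d : ℕ} {G : (Fin d → ℂ) → ℂ}
    (hG : ∀ z, (∀ j, ‖z j‖ ≤ 1) → DifferentiableAt ℂ G z) :
    Continuous fun ζ => G (torusIncl ζ) :=
  continuous_iff_continuousAt.mpr fun ζ => ContinuousAt.comp (g := G)
    (hG _ (norm_torusIncl_le ζ)).continuousAt continuous_torusIncl.continuousAt

theorem integrable_of_continuous {X E : Type*} [TopologicalSpace X] [CompactSpace X]
    [MeasurableSpace X] [OpensMeasurableSpace X] [NormedAddCommGroup E]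
    [SecondCountableTopologyEither X E] {μ : Measure X} [IsFiniteMeasure μ] {g : X → E}
    (hg : Continuous g) : Integrable g μ :=
  hg.integrable_of_hasCompactSupport (HasCompactSupport.of_compactSpace _)

theorem continuous_poissonKernel {d : ℕ} {X : Type*} [TopologicalSpace X] {z : X → Polydisc d}
    {ζ : X → Torus d} (hz : Continuous z) (hζ : Continuous ζ) :
    Continuous fun x => poissonKernel (z x) (ζ x) := by
  unfold poissonKernel
  have hz' : ∀ j, Continuous fun x => (z x).1 j := fun j =>
    (continuous_apply j).comp (continuous_subtype_val.comp hz)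
  have hζ' : ∀ j, Continuous fun x => (ζ x j : ℂ) := fun j =>
    continuous_circle_coe.comp ((continuous_apply j).comp hζ)
  refine continuous_finsetProd _ fun j _ => Continuous.div ?_ ?_ fun x => ?_
  · exact continuous_const.sub ((hz' j).norm.pow 2)
  · exact ((hζ' j).sub (hz' j)).norm.pow 2
  · simpa using circle_sub_ne_zero (ζ x j) ((z x).2 j)

/-- The Poisson integral formula on the polydisc. -/
theorem integral_poissonKernel_mul : ∀ {d : ℕ} {G : (Fin d → ℂ) → ℂ}
    (_ : ∀ z, (∀ j, ‖z j‖ ≤ 1) → DifferentiableAt ℂ G z) (z : Polydisc d),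
    ∫ ζ, (poissonKernel z ζ : ℂ) * G (torusIncl ζ) ∂torusHaar d = G z.1
  | 0, G, hG, z => by
    have : ∀ ζ : Torus 0, (poissonKernel z ζ : ℂ) * G (torusIncl ζ) = G z.1 := fun ζ => by
      rw [Subsingleton.elim (torusIncl ζ) z.1]; simp [poissonKernel]
    simp [this]
  | d + 1, G, hG, z => by
    -- Fubini splits off the first coordinate: the inner integral is the case `d` with that
    -- coordinate fixed on the circle, the outer one is the Poisson formula on the disc.
    have hmp := (measurePreserving_piFinSuccAbove (fun _ : Fin (d + 1) => circleMeasure) 0).symm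
    have hcont : Continuous fun ζ : Torus (d + 1) =>
        (poissonKernel z ζ : ℂ) * G (torusIncl ζ) :=
      (Complex.continuous_ofReal.comp (continuous_poissonKernel continuous_const
        continuous_id)).mul (continuous_comp_torusIncl hG)
    have hint := integrable_of_continuous (μ := torusHaar (d + 1)) hcont
    rw [torusHaar, ← hmp.integral_comp' (g := fun ζ : Torus (d + 1) =>
        (poissonKernel z ζ : ℂ) * G (torusIncl ζ)), integral_prod]
    · have hz' : ∀ j : Fin d, ‖z.1 j.succ‖ < 1 := fun j => z.2 _
      have hincl : ∀ (x : Circle) (y : Torus d),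
          torusIncl (Fin.cons x y : Torus (d + 1)) = Fin.cons (x : ℂ) (torusIncl y) := by
        intro x y; ext j; refine Fin.cases ?_ (fun j => ?_) j <;> simp [torusIncl]
      have hker : ∀ (x : Circle) (y : Torus d), poissonKernel z (Fin.cons x y : Torus (d + 1)) =
          (1 - ‖z.1 0‖ ^ 2) / ‖(x : ℂ) - z.1 0‖ ^ 2 *
            poissonKernel ⟨fun j => z.1 j.succ, hz'⟩ y := by
        intro x y; simp only [poissonKernel, Fin.prod_univ_succ, Fin.cons_zero, Fin.cons_succ]
      have hd1 : ∀ w : ℂ, ‖w‖ ≤ 1 → ∀ y : Fin d → ℂ, (∀ j, ‖y j‖ ≤ 1) →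
          DifferentiableAt ℂ G (Fin.cons w y) := fun w hw y hy =>
        hG _ fun j => Fin.cases (by simpa using hw) (fun j => by simpa using hy j) j
      have hconsy : ∀ w : ℂ, Differentiable ℂ fun y : Fin d → ℂ => (Fin.cons w y : Fin (d+1) → ℂ) :=
        fun w => differentiable_pi.mpr fun j =>
          Fin.cases (by simp) (fun j => by simpa using differentiable_apply j) j
      have hconsw : ∀ y : Fin d → ℂ, Differentiable ℂ fun w : ℂ => (Fin.cons w y : Fin (d+1) → ℂ) :=
        fun y => differentiable_pi.mpr fun j =>
          Fin.cases (by simp) (fun j => by simp) j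
      have hinner : ∀ x : Circle, ∫ y : Torus d, (poissonKernel ⟨fun j => z.1 j.succ, hz'⟩ y : ℂ) *
          G (Fin.cons (x : ℂ) (torusIncl y)) ∂torusHaar d =
            G (Fin.cons (x : ℂ) fun j => z.1 j.succ) := fun x =>
        integral_poissonKernel_mul (G := fun y => G (Fin.cons (x : ℂ) y))
          (fun y hy => DifferentiableAt.comp (g := G) y (hd1 x (Circle.norm_coe x).le y hy) (hconsy _ y))
          ⟨fun j => z.1 j.succ, hz'⟩
      have houter := integral_poisson_circle (g := fun w => G (Fin.cons w fun j => z.1 j.succ))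
        (fun w hw => DifferentiableAt.comp (g := G) w (hd1 w hw _ fun j => (hz' j).le)
          (hconsw _ w)) (z.2 0)
      rw [show z.1 = Fin.cons (z.1 0) fun j => z.1 j.succ by
        ext j; refine Fin.cases ?_ (fun j => ?_) j <;> simp]
      rw [← houter]
      refine integral_congr_ae (.of_forall fun x => ?_)
      simp only
      rw [← hinner x, ← integral_const_mul]
      refine integral_congr_ae (.of_forall fun y => ?_)
      have he : (MeasurableEquiv.piFinSuccAbove (fun _ : Fin (d + 1) => Circle) 0).symm (x, y) =
          (Fin.cons x y : Torus (d + 1)) := by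
        simp [MeasurableEquiv.piFinSuccAbove, Fin.insertNthEquiv]
      simp only [he, hker, hincl]
      push_cast
      ring
    · exact (hmp.integrable_comp hint.1).mpr hint

/-- The mean value property. -/
theorem integral_torusHaar {d : ℕ} {G : (Fin d → ℂ) → ℂ}
    (hG : ∀ z, (∀ j, ‖z j‖ ≤ 1) → DifferentiableAt ℂ G z) :
    ∫ ζ, G (torusIncl ζ) ∂torusHaar d = G 0 := by
  simpa [poissonKernel, origin, Circle.norm_coe] using integral_poissonKernel_mul hG (origin d)

/-! ### Fourier coefficients and uniqueness of the measure -/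

/-- The monomial `ζ ↦ ∏ j, ζ_j ^ k_j` on the torus, with integral exponents. -/
def torusMonomial {d : ℕ} (k : Fin d → ℤ) (ζ : Torus d) : ℂ := ∏ j, (ζ j : ℂ) ^ k j

theorem continuous_torusMonomial {d : ℕ} (k : Fin d → ℤ) : Continuous (torusMonomial k) :=
  continuous_finsetProd _ fun j _ =>
    (continuous_circle_coe.comp (continuous_apply j)).zpow₀ _ fun ζ => .inl (ζ j).coe_ne_zero

/-- This symmetry lets the Poisson kernel of the point `η / 2` at `ζ` be read as the kernel of `ζ /
2` at `η`, so that integration over `η` becomes a Poisson integral. -/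
theorem norm_circle_sub_half (ζ η : Circle) :
    ‖(ζ : ℂ) - (η : ℂ) / 2‖ = ‖(η : ℂ) - (ζ : ℂ) / 2‖ := by
  have h : ∀ x : Circle, conj (x : ℂ) * x = 1 := fun x => by
    rw [Complex.conj_mul', Circle.norm_coe]; simp
  have : (ζ : ℂ) - (η : ℂ) / 2 = ζ * η * conj ((η : ℂ) - (ζ : ℂ) / 2) := by
    simp only [map_sub, map_div₀, map_ofNat]
    linear_combination (-(ζ : ℂ)) * h η + (η : ℂ) / 2 * h ζ
  rw [this, norm_mul, norm_mul, Circle.norm_coe, Circle.norm_coe, RCLike.norm_conj]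
  ring

/-- The Poisson kernel of a point at radius `1 / 2` acts diagonally on the powers of the
coordinate. -/
theorem integral_poisson_zpow (k : ℤ) (ζ : Circle) :
    ∫ η : Circle, (((1 - ‖(η : ℂ) / 2‖ ^ 2) / ‖(ζ : ℂ) - (η : ℂ) / 2‖ ^ 2 : ℝ) : ℂ) *
      (η : ℂ) ^ k ∂circleMeasure = (1 / 2) ^ k.natAbs * (ζ : ℂ) ^ k := by
  have hn : ∀ n : ℕ, ∫ η : Circle,
      (((1 - ‖(η : ℂ) / 2‖ ^ 2) / ‖(ζ : ℂ) - (η : ℂ) / 2‖ ^ 2 : ℝ) : ℂ) *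
      (η : ℂ) ^ n ∂circleMeasure = (1 / 2) ^ n * (ζ : ℂ) ^ n := by
    intro n
    have hz : ‖(ζ : ℂ) / 2‖ < 1 := by rw [norm_div, Circle.norm_coe]; norm_num
    have h := integral_poisson_circle (g := fun w => w ^ n) (fun w _ => by fun_prop) hz
    rw [← mul_pow, show (1 / 2 : ℂ) * ζ = ζ / 2 by ring, ← h]
    refine integral_congr_ae (.of_forall fun η => ?_)
    simp only [norm_circle_sub_half ζ η]
    simp only [norm_div, Circle.norm_coe]
  have hconj : ∀ (x : Circle) (n : ℕ), (x : ℂ) ^ (-(n : ℤ)) = conj ((x : ℂ) ^ n) := by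
    intro x n
    rw [zpow_neg, zpow_natCast, map_pow, ← Circle.coe_inv_eq_conj, Circle.coe_inv, inv_pow]
  obtain ⟨n, rfl | rfl⟩ := k.eq_nat_or_neg
  · simpa using hn n
  -- The kernel is real, so negative exponents follow by conjugation.
  · have h := congrArg conj (hn n)
    rw [← integral_conj] at h
    simp only [map_mul, Complex.conj_ofReal] at h
    simp only [hconj, Int.natAbs_neg, Int.natAbs_natCast]
    rw [h]
    simp [Complex.conj_ofNat]

/-- The point of the polydisc at radius `1 / 2` under a point of the torus. -/
def halfPoint {d : ℕ} (η : Torus d) : Polydisc d :=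
  ⟨fun j => (η j : ℂ) / 2, fun j => by rw [norm_div, Circle.norm_coe]; norm_num⟩

theorem continuous_halfPoint {d : ℕ} : Continuous (halfPoint (d := d)) :=
  Continuous.subtype_mk (continuous_pi fun j =>
    (continuous_circle_coe.comp (continuous_apply j)).div_const 2) _

theorem integral_poissonKernel_halfPoint {d : ℕ} (k : Fin d → ℤ) (ζ : Torus d) :
    ∫ η, (poissonKernel (halfPoint η) ζ : ℂ) * torusMonomial k η ∂torusHaar d =
      (∏ j, (1 / 2 : ℂ) ^ (k j).natAbs) * torusMonomial k ζ := by
  have h : ∀ η : Torus d, (poissonKernel (halfPoint η) ζ : ℂ) * torusMonomial k η =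
      ∏ j, (((1 - ‖(η j : ℂ) / 2‖ ^ 2) / ‖(ζ j : ℂ) - (η j : ℂ) / 2‖ ^ 2 : ℝ) : ℂ) *
        (η j : ℂ) ^ k j := fun η => by
    rw [poissonKernel, torusMonomial, Complex.ofReal_prod, ← Finset.prod_mul_distrib]
    rfl
  simp only [h]
  rw [torusHaar, integral_fintype_prod_eq_prod (fun j (x : Circle) =>
    (((1 - ‖(x : ℂ) / 2‖ ^ 2) / ‖(ζ j : ℂ) - (x : ℂ) / 2‖ ^ 2 : ℝ) : ℂ) * (x : ℂ) ^ k j),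
    torusMonomial, ← Finset.prod_mul_distrib]
  exact Finset.prod_congr rfl fun j _ => integral_poisson_zpow (k j) (ζ j)

/-- The Fourier coefficients of a measure on the torus are determined by its Poisson integral. -/
theorem integral_torusMonomial {d : ℕ} (μ : Measure (Torus d)) [IsFiniteMeasure μ]
    (k : Fin d → ℤ) :
    (∏ j, (1 / 2 : ℂ) ^ (k j).natAbs) * ∫ ζ, torusMonomial k ζ ∂μ =
      ∫ η, ((∫ ζ, poissonKernel (halfPoint η) ζ ∂μ : ℝ) : ℂ) * torusMonomial k η ∂torusHaar d := by
  rw [← integral_const_mul]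
  simp only [← integral_poissonKernel_halfPoint, ← integral_complex_ofReal,
    ← integral_mul_const]
  refine integral_integral_swap (integrable_of_continuous ?_)
  refine Continuous.mul ?_ ((continuous_torusMonomial k).comp continuous_snd)
  exact Complex.continuous_ofReal.comp
    (continuous_poissonKernel (continuous_halfPoint.comp continuous_snd) continuous_fst)

/-- The monomials as bounded continuous functions on the torus. -/
def boundedMonomials (d : ℕ) : Set (BoundedContinuousFunction (Torus d) ℂ) :=
  Set.range fun k : Fin d → ℤ =>
    BoundedContinuousFunction.mkOfCompact ⟨torusMonomial k, continuous_torusMonomial k⟩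

/-- The star subalgebra of functions on the torus spanned by the monomials. -/
def monomialAlgebra (d : ℕ) : StarSubalgebra ℂ (BoundedContinuousFunction (Torus d) ℂ) where
  toSubalgebra := Algebra.adjoin ℂ (boundedMonomials d)
  star_mem' := by
    change Algebra.adjoin ℂ _ ≤ star (Algebra.adjoin ℂ _)
    refine Algebra.adjoin_le ?_
    rintro - ⟨k, rfl⟩
    refine Algebra.subset_adjoin ⟨-k, ?_⟩
    ext ζ
    simp [torusMonomial, ← Circle.coe_inv_eq_conj]

/-- The monomials are closed under multiplication and contain `1`, so generating an algebra adds
only linear combinations. -/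
theorem mem_monomialAlgebra {d : ℕ} {g : BoundedContinuousFunction (Torus d) ℂ}
    (hg : g ∈ monomialAlgebra d) : g ∈ Submodule.span ℂ (boundedMonomials d) := by
  have h : Subalgebra.toSubmodule (Algebra.adjoin ℂ (boundedMonomials d)) =
      Submodule.span ℂ (boundedMonomials d) := by
    apply Algebra.adjoin_eq_span_of_subset
    refine .trans (fun x ↦ Submonoid.closure_induction (fun _ ↦ id) ⟨0, ?_⟩ ?_)
      Submodule.subset_span
    · ext ζ
      simp [torusMonomial]
    · rintro _ _ _ _ ⟨m, rfl⟩ ⟨n, rfl⟩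
      refine ⟨m + n, ?_⟩
      ext ζ
      simp [torusMonomial, zpow_add₀, Finset.prod_mul_distrib]
  rw [← h]
  exact hg

/-- A finite measure on the torus is determined by its Poisson integral. -/
theorem measure_eq_of_poisson {d : ℕ} {μ μ' : Measure (Torus d)} [IsFiniteMeasure μ]
    [IsFiniteMeasure μ']
    (h : ∀ z, ∫ ζ, poissonKernel z ζ ∂μ = ∫ ζ, poissonKernel z ζ ∂μ') : μ = μ' := by
  refine ext_of_forall_mem_subalgebra_integral_eq_of_pseudoEMetric_complete_countable
    (𝕜 := ℂ) (A := monomialAlgebra d) ?_ fun g hg => ?_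
  · intro x y hxy
    obtain ⟨i, hi⟩ := Function.ne_iff.mp hxy
    refine ⟨torusMonomial (Pi.single i 1), ⟨⟨torusMonomial (Pi.single i 1),
      continuous_torusMonomial _⟩, ⟨BoundedContinuousFunction.mkOfCompact ⟨_,
      continuous_torusMonomial _⟩, Algebra.subset_adjoin ⟨Pi.single i 1, rfl⟩, rfl⟩, rfl⟩, ?_⟩
    have hs : ∀ ζ : Torus d, torusMonomial (Pi.single i 1) ζ = ζ i := fun ζ => by
      rw [torusMonomial, Finset.prod_eq_single i] <;> simp +contextual
    rw [hs, hs]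
    exact fun h' => hi (Circle.ext h')
  · refine Submodule.span_induction (p := fun g _ => ∫ x, g x ∂μ = ∫ x, g x ∂μ') ?_ ?_ ?_ ?_
      (mem_monomialAlgebra hg)
    · rintro - ⟨k, rfl⟩
      -- The eigenvalue does not vanish, so it cancels and the Fourier coefficients agree.
      have hk : (∏ j, (1 / 2 : ℂ) ^ (k j).natAbs) ≠ 0 :=
        Finset.prod_ne_zero_iff.mpr fun j _ => by simp
      refine mul_left_cancel₀ hk ?_
      have h1 := integral_torusMonomial μ k
      simp only [h] at h1
      exact h1.trans (integral_torusMonomial μ' k).symm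
    · simp
    · intro x y _ _ hx hy
      simp only [BoundedContinuousFunction.coe_add, Pi.add_apply]
      rw [integral_add (x.integrable μ) (y.integrable μ),
        integral_add (x.integrable μ') (y.integrable μ'), hx, hy]
    · intro a x _ hx
      simp only [BoundedContinuousFunction.coe_smul, integral_smul, hx]

/-! ### Weak convergence through the Poisson transform -/

/-- The Poisson integral of a probability measure on the torus. -/
def poissonTransform (d : ℕ) (μ : ProbabilityMeasure (Torus d)) (z : Polydisc d) : ℝ :=
  ∫ ζ, poissonKernel z ζ ∂(μ : Measure (Torus d))

/-- The probability measures on the compact torus form a compact space, and a continuous injection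
of it into a Hausdorff space is a closed embedding. -/
theorem isClosedEmbedding_poissonTransform (d : ℕ) :
    IsClosedEmbedding (poissonTransform d) := by
  refine Continuous.isClosedEmbedding (continuous_pi fun z => ?_) fun μ μ' h => ?_
  · rw [continuous_iff_continuousAt]
    intro μ
    exact ProbabilityMeasure.tendsto_iff_forall_integral_tendsto.mp tendsto_id
      (BoundedContinuousFunction.mkOfCompact
        ⟨poissonKernel z, continuous_poissonKernel continuous_const continuous_id⟩)
  · exact Subtype.ext (measure_eq_of_poisson (μ := (μ : Measure (Torus d)))
      (μ' := (μ' : Measure (Torus d))) fun z => congrFun h z)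

theorem isDeterminedBy_iff {d : ℕ} {μ : ProbabilityMeasure (Torus d)} {f : HolSpace d} :
    IsDeterminedBy μ f ↔ poissonTransform d μ = fun z => ((1 + f.1 z) / (1 - f.1 z)).re := by
  rw [funext_iff]
  exact forall_congr' fun z => eq_comm

theorem IsDeterminedBy.unique {d : ℕ} {μ μ' : ProbabilityMeasure (Torus d)} {f : HolSpace d}
    (h : IsDeterminedBy μ f) (h' : IsDeterminedBy μ' f) : μ = μ' :=
  (isClosedEmbedding_poissonTransform d).injective
    ((isDeterminedBy_iff.mp h).trans (isDeterminedBy_iff.mp h').symm)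

theorem IsDeterminedBy.schurMeasure_eq {d : ℕ} {μ : ProbabilityMeasure (Torus d)} {f : HolSpace d}
    (h : IsDeterminedBy μ f) : schurMeasure f = μ :=
  IsDeterminedBy.unique (Classical.epsilon_spec (p := fun μ => IsDeterminedBy μ f) ⟨μ, h⟩) h

/-- Measures determined by a pointwise convergent sequence of functions converge weakly. -/
theorem exists_isDeterminedBy_of_tendsto {d : ℕ} {μ : ℕ → ProbabilityMeasure (Torus d)}
    {f : HolSpace d} {g : ℕ → HolSpace d} (hμ : ∀ n, IsDeterminedBy (μ n) (g n))
    (hg : ∀ z, Tendsto (fun n => (g n).1 z) atTop (𝓝 (f.1 z))) (hf : ∀ z, f.1 z ≠ 1) :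
    ∃ μ₀, IsDeterminedBy μ₀ f ∧ Tendsto μ atTop (𝓝 μ₀) := by
  have hlim : Tendsto (fun n => poissonTransform d (μ n)) atTop
      (𝓝 fun z => ((1 + f.1 z) / (1 - f.1 z)).re) := by
    refine tendsto_pi_nhds.mpr fun z => ?_
    simp only [isDeterminedBy_iff.mp (hμ _)]
    exact (Complex.continuous_re.tendsto _).comp (((hg z).const_add 1).div ((hg z).const_sub 1)
      (sub_ne_zero.mpr (hf z).symm))
  have hemb := isClosedEmbedding_poissonTransform d
  -- Closedness of the range produces the limit measure; the embedding then gives weak convergence.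
  obtain ⟨μ₀, hμ₀⟩ := hemb.isClosed_range.mem_of_tendsto hlim
    (.of_forall fun n => Set.mem_range_self _)
  refine ⟨μ₀, isDeterminedBy_iff.mpr hμ₀, ?_⟩
  rw [hemb.isInducing.tendsto_nhds_iff, hμ₀]
  exact hlim

/-! ### Entries of the matrix products -/

section

/-- The upper left entry of `P_n`, as a function on `ℂ^d`. -/
def upperLeft {d : ℕ} (r : ℕ → Complex.UnitClosedDisc) (ν : ℕ → Fin d) (n : ℕ)
    (z : Fin d → ℂ) : ℂ := MvPolynomial.eval z (transferProduct r ν n 0 0)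

/-- The upper right entry of `P_n`, as a function on `ℂ^d`. -/
def upperRight {d : ℕ} (r : ℕ → Complex.UnitClosedDisc) (ν : ℕ → Fin d) (n : ℕ)
    (z : Fin d → ℂ) : ℂ := MvPolynomial.eval z (transferProduct r ν n 0 1)

/-- The polynomial `Φ_n`, as a function on `ℂ^d`. -/
def phi {d : ℕ} (r : ℕ → Complex.UnitClosedDisc) (ν : ℕ → Fin d) (n : ℕ)
    (z : Fin d → ℂ) : ℂ := MvPolynomial.eval z (orthoPoly r ν n)

/-- The lower right entry of `P_n`, as a function on `ℂ^d`; it is the reverse of `Φ_n`. -/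
def phiStar {d : ℕ} (r : ℕ → Complex.UnitClosedDisc) (ν : ℕ → Fin d) (n : ℕ)
    (z : Fin d → ℂ) : ℂ := MvPolynomial.eval z (transferProduct r ν n 1 1)

/-- The monomial `z_{ν_1} ⋯ z_{ν_n}`. -/
def allocMonomial {d : ℕ} (ν : ℕ → Fin d) (n : ℕ) (z : Fin d → ℂ) : ℂ :=
  ∏ s ∈ Finset.range n, z (ν (s + 1))

/-- The weight `∏ (1 - |r_s|²)`, `1 ≤ s ≤ n`. -/
def weight (r : ℕ → Complex.UnitClosedDisc) (n : ℕ) : ℝ :=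
  ∏ s ∈ Finset.Icc 1 n, (1 - ‖(r s : ℂ)‖ ^ 2)

variable {d : ℕ} (r : ℕ → Complex.UnitClosedDisc) (ν : ℕ → Fin d)

theorem upperLeft_zero (z : Fin d → ℂ) : upperLeft r ν 0 z = 1 := by
  simp [upperLeft, transferProduct, transferMatrix]

theorem upperRight_zero (z : Fin d → ℂ) : upperRight r ν 0 z = 1 := by
  simp [upperRight, transferProduct, transferMatrix]

theorem phi_zero (z : Fin d → ℂ) : phi r ν 0 z = 1 := by
  simp [phi, orthoPoly, transferProduct, transferMatrix]

theorem phiStar_zero (z : Fin d → ℂ) : phiStar r ν 0 z = 1 := by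
  simp [phiStar, transferProduct, transferMatrix]

theorem upperLeft_succ (n : ℕ) (z : Fin d → ℂ) : upperLeft r ν (n + 1) z =
    z (ν (n + 1)) * upperLeft r ν n z + conj (r (n + 1) : ℂ) * upperRight r ν n z := by
  simp [upperLeft, upperRight, transferProduct, transferMatrix, Matrix.mul_apply, mul_comm]

theorem upperRight_succ (n : ℕ) (z : Fin d → ℂ) : upperRight r ν (n + 1) z =
    upperRight r ν n z + (r (n + 1) : ℂ) * (z (ν (n + 1)) * upperLeft r ν n z) := by
  simp [upperLeft, upperRight, transferProduct, transferMatrix, Matrix.mul_apply]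
  ring

theorem phi_succ (n : ℕ) (z : Fin d → ℂ) : phi r ν (n + 1) z =
    z (ν (n + 1)) * phi r ν n z - conj (r (n + 1) : ℂ) * phiStar r ν n z := by
  simp [phi, phiStar, orthoPoly, transferProduct, transferMatrix, Matrix.mul_apply]
  ring

theorem phiStar_succ (n : ℕ) (z : Fin d → ℂ) : phiStar r ν (n + 1) z =
    phiStar r ν n z - (r (n + 1) : ℂ) * (z (ν (n + 1)) * phi r ν n z) := by
  simp [phi, phiStar, orthoPoly, transferProduct, transferMatrix, Matrix.mul_apply]
  ring

theorem allocMonomial_zero (z : Fin d → ℂ) : allocMonomial ν 0 z = 1 := by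
  simp [allocMonomial]

theorem allocMonomial_succ (n : ℕ) (z : Fin d → ℂ) :
    allocMonomial ν (n + 1) z = allocMonomial ν n z * z (ν (n + 1)) := by
  simp [allocMonomial, Finset.prod_range_succ]

theorem weight_zero : weight r 0 = 1 := by simp [weight]

theorem weight_succ (n : ℕ) : weight r (n + 1) = weight r n * (1 - ‖(r (n + 1) : ℂ)‖ ^ 2) := by
  rw [weight, weight, Finset.prod_Icc_succ_top (by omega)]

variable {r}

theorem weight_pos (hr : ∀ n, ‖(r n : ℂ)‖ < 1) (n : ℕ) : 0 < weight r n :=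
  Finset.prod_pos fun s _ => by nlinarith [hr s, norm_nonneg (r s : ℂ)]

variable (r)

theorem differentiable_entries (n : ℕ) : (Differentiable ℂ (upperLeft r ν n) ∧
    Differentiable ℂ (upperRight r ν n)) ∧
      Differentiable ℂ (phi r ν n) ∧ Differentiable ℂ (phiStar r ν n) := by
  induction n with
  | zero =>
    simp only [funext (upperLeft_zero r ν), funext (upperRight_zero r ν), funext (phi_zero r ν),
      funext (phiStar_zero r ν)]
    refine ⟨⟨?_, ?_⟩, ?_, ?_⟩ <;> fun_prop
  | succ n ih =>
    obtain ⟨⟨h1, h2⟩, h3, h4⟩ := ih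
    simp only [funext (upperLeft_succ r ν n), funext (upperRight_succ r ν n),
      funext (phi_succ r ν n), funext (phiStar_succ r ν n)]
    refine ⟨⟨?_, ?_⟩, ?_, ?_⟩ <;> fun_prop

theorem differentiable_upperRight (n : ℕ) : Differentiable ℂ (upperRight r ν n) :=
  (differentiable_entries r ν n).1.2

theorem differentiable_phi (n : ℕ) : Differentiable ℂ (phi r ν n) :=
  (differentiable_entries r ν n).2.1

theorem differentiable_phiStar (n : ℕ) : Differentiable ℂ (phiStar r ν n) :=
  (differentiable_entries r ν n).2.2

theorem upperRight_at_zero (n : ℕ) : upperRight r ν n 0 = 1 := by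
  induction n with
  | zero => exact upperRight_zero r ν 0
  | succ n ih => simp [upperRight_succ, ih]

theorem phiStar_at_zero (n : ℕ) : phiStar r ν n 0 = 1 := by
  induction n with
  | zero => exact phiStar_zero r ν 0
  | succ n ih => simp [phiStar_succ, ih]

/-- Determinants multiply: `det M_0 = 2` and `det M_s = z_{ν_s} (1 - |r_s|²)`. The plus sign arises
because the lower left entry is `-Φ_n`. -/
theorem det_transferProduct (n : ℕ) (z : Fin d → ℂ) :
    upperLeft r ν n z * phiStar r ν n z + upperRight r ν n z * phi r ν n z =
      2 * allocMonomial ν n z * weight r n := by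
  induction n with
  | zero =>
    simp only [upperLeft_zero, upperRight_zero, phi_zero, phiStar_zero, allocMonomial_zero,
      weight_zero]
    norm_num
  | succ n ih =>
    have hc := Complex.conj_mul' (r (n + 1) : ℂ)
    rw [upperLeft_succ, upperRight_succ, phi_succ, phiStar_succ, allocMonomial_succ, weight_succ]
    push_cast
    rw [← hc]
    linear_combination (z (ν (n + 1)) * (1 - conj (r (n + 1) : ℂ) * r (n + 1))) * ih

/-- The functions `(1 + f_n) / (1 - f_n)` differ by terms of high order at the origin. -/
theorem upperRight_mul_phiStar_sub (n : ℕ) (z : Fin d → ℂ) :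
    upperRight r ν (n + 1) z * phiStar r ν n z - upperRight r ν n z * phiStar r ν (n + 1) z =
      2 * (r (n + 1) : ℂ) * weight r n * allocMonomial ν (n + 1) z := by
  rw [upperRight_succ, phiStar_succ, allocMonomial_succ]
  linear_combination ((r (n + 1) : ℂ) * z (ν (n + 1))) * det_transferProduct r ν n z

variable {r}

/-- The recurrences say that `Φ_{n+1} / Φ_{n+1}^*` is the image of `ξ = z_{ν_{n+1}} Φ_n / Φ_n^*`
under the disc map with parameter `-conj r_{n+1}`. That map preserves the closed disc and its
denominator has no zeros there. -/
theorem phiStar_ne_zero_and_norm_phi_le (hr : ∀ n, ‖(r n : ℂ)‖ < 1) (n : ℕ) {z : Fin d → ℂ}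
    (hz : ∀ j, ‖z j‖ ≤ 1) : phiStar r ν n z ≠ 0 ∧ ‖phi r ν n z‖ ≤ ‖phiStar r ν n z‖ := by
  induction n with
  | zero => simp [phi_zero, phiStar_zero]
  | succ n ih =>
    obtain ⟨h0, hle⟩ := ih
    set ξ := z (ν (n + 1)) * phi r ν n z / phiStar r ν n z with hξ
    have hx : ‖ξ‖ ≤ 1 := by
      rw [hξ, norm_div, norm_mul]
      refine div_le_one_of_le₀ ?_ (norm_nonneg _)
      exact (mul_le_of_le_one_left (norm_nonneg _) (hz _)).trans hle
    have hzphi : z (ν (n + 1)) * phi r ν n z = ξ * phiStar r ν n z := by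
      rw [hξ, div_mul_cancel₀ _ h0]
    have hr' : ‖-conj (r (n + 1) : ℂ)‖ < 1 := by simpa using hr (n + 1)
    have hden := one_add_conj_mul_ne_zero hr' hx
    have hb := norm_discMap_le_one hr'.le hx
    have hs : phiStar r ν (n + 1) z =
        (1 + conj (-conj (r (n + 1) : ℂ)) * ξ) * phiStar r ν n z := by
      rw [phiStar_succ, hzphi]
      simp only [map_neg, Complex.conj_conj]
      ring
    have hp : phi r ν (n + 1) z = (ξ + -conj (r (n + 1) : ℂ)) * phiStar r ν n z := by
      rw [phi_succ, hzphi]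
      ring
    rw [discMap, if_pos hr', norm_div, div_le_one (norm_pos_iff.mpr hden)] at hb
    rw [hs, hp, norm_mul, norm_mul]
    exact ⟨mul_ne_zero hden h0, mul_le_mul_of_nonneg_right hb (norm_nonneg _)⟩

theorem phiStar_ne_zero (hr : ∀ n, ‖(r n : ℂ)‖ < 1) (n : ℕ) {z : Fin d → ℂ}
    (hz : ∀ j, ‖z j‖ ≤ 1) : phiStar r ν n z ≠ 0 :=
  (phiStar_ne_zero_and_norm_phi_le ν hr n hz).1

variable (r)

/-! ### Reversal and boundary values on the torus -/

theorem conj_torusIncl_mul (ζ : Torus d) (j : Fin d) :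
    conj (torusIncl ζ j) * torusIncl ζ j = 1 := by
  rw [Complex.conj_mul', torusIncl, Circle.norm_coe]; simp

theorem torusIncl_mul_conj (ζ : Torus d) (j : Fin d) :
    torusIncl ζ j * conj (torusIncl ζ j) = 1 := by
  rw [mul_comm, conj_torusIncl_mul]

theorem allocMonomial_mul_conj (n : ℕ) (ζ : Torus d) :
    allocMonomial ν n (torusIncl ζ) * conj (allocMonomial ν n (torusIncl ζ)) = 1 := by
  simp [allocMonomial, ← Finset.prod_mul_distrib, torusIncl_mul_conj]

/-- Conjugation interchanges the two recurrences, up to a coordinate factor, because `ζ_j conj ζ_j =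
1`. It lets `conj Φ_k` be replaced by a polynomial once multiplied by the monomial. -/
theorem phi_eq_on_torus (n : ℕ) (ζ : Torus d) :
    phi r ν n (torusIncl ζ) = allocMonomial ν n (torusIncl ζ) * conj (phiStar r ν n (torusIncl ζ)) ∧
    phiStar r ν n (torusIncl ζ) = allocMonomial ν n (torusIncl ζ) * conj (phi r ν n (torusIncl ζ)) := by
  induction n with
  | zero => simp [phi_zero, phiStar_zero, allocMonomial_zero]
  | succ n ih =>
    obtain ⟨h1, h2⟩ := ih
    have hz := torusIncl_mul_conj ζ (ν (n + 1))
    rw [phi_succ, phiStar_succ, allocMonomial_succ]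
    simp only [map_sub, map_mul, Complex.conj_conj]
    constructor
    · linear_combination (torusIncl ζ (ν (n + 1))) * h1 - conj (r (n + 1) : ℂ) * h2 +
        (conj (r (n + 1) : ℂ) * allocMonomial ν n (torusIncl ζ) *
          conj (phi r ν n (torusIncl ζ))) * hz
    · linear_combination h2 - ((r (n + 1) : ℂ) * torusIncl ζ (ν (n + 1))) * h1 -
        (allocMonomial ν n (torusIncl ζ) * conj (phi r ν n (torusIncl ζ))) * hz

theorem upper_eq_on_torus (n : ℕ) (ζ : Torus d) :
    upperLeft r ν n (torusIncl ζ) =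
      allocMonomial ν n (torusIncl ζ) * conj (upperRight r ν n (torusIncl ζ)) ∧
    upperRight r ν n (torusIncl ζ) =
      allocMonomial ν n (torusIncl ζ) * conj (upperLeft r ν n (torusIncl ζ)) := by
  induction n with
  | zero => simp [upperLeft_zero, upperRight_zero, allocMonomial_zero]
  | succ n ih =>
    obtain ⟨h1, h2⟩ := ih
    have hz := torusIncl_mul_conj ζ (ν (n + 1))
    rw [upperLeft_succ, upperRight_succ, allocMonomial_succ]
    simp only [map_add, map_mul, Complex.conj_conj]
    constructor
    · linear_combination (torusIncl ζ (ν (n + 1))) * h1 + conj (r (n + 1) : ℂ) * h2 -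
        (conj (r (n + 1) : ℂ) * allocMonomial ν n (torusIncl ζ) *
          conj (upperLeft r ν n (torusIncl ζ))) * hz
    · linear_combination h2 + ((r (n + 1) : ℂ) * torusIncl ζ (ν (n + 1))) * h1 -
        (allocMonomial ν n (torusIncl ζ) * conj (upperLeft r ν n (torusIncl ζ))) * hz

/-- The Carathéodory function `(1 + f_n) / (1 - f_n)` of the `n`-th convergent. -/
def carath (n : ℕ) (z : Fin d → ℂ) : ℂ := upperRight r ν n z / phiStar r ν n z

variable {r}

theorem differentiableAt_carath (hr : ∀ n, ‖(r n : ℂ)‖ < 1) (n : ℕ) {z : Fin d → ℂ}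
    (hz : ∀ j, ‖z j‖ ≤ 1) : DifferentiableAt ℂ (carath r ν n) z :=
  ((differentiable_upperRight r ν n z).mul ((differentiable_phiStar r ν n z).inv
    (phiStar_ne_zero ν hr n hz))).congr_of_eventuallyEq (.of_forall fun _ => div_eq_mul_inv _ _)

theorem phi_ne_zero_on_torus (hr : ∀ n, ‖(r n : ℂ)‖ < 1) (n : ℕ) (ζ : Torus d) :
    phi r ν n (torusIncl ζ) ≠ 0 := by
  intro h
  have := (phi_eq_on_torus r ν n ζ).2
  rw [h, map_zero, mul_zero] at this
  exact phiStar_ne_zero ν hr n (norm_torusIncl_le ζ) this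

theorem carath_re_on_torus (hr : ∀ n, ‖(r n : ℂ)‖ < 1) (n : ℕ) (ζ : Torus d) :
    (((carath r ν n (torusIncl ζ)).re : ℝ) : ℂ) =
      weight r n / (phi r ν n (torusIncl ζ) * conj (phi r ν n (torusIncl ζ))) := by
  have h0 := phiStar_ne_zero ν hr n (norm_torusIncl_le ζ)
  have h1 := phi_ne_zero_on_torus ν hr n ζ
  have h0' : conj (phiStar r ν n (torusIncl ζ)) ≠ 0 := by simpa using h0
  have h1' : conj (phi r ν n (torusIncl ζ)) ≠ 0 := by simpa using h1
  have hdet := det_transferProduct r ν n (torusIncl ζ)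
  have hZ := allocMonomial_mul_conj ν n ζ
  obtain ⟨hp, hs⟩ := phi_eq_on_torus r ν n ζ
  obtain ⟨hu, -⟩ := upper_eq_on_torus r ν n ζ
  have hnorm : phi r ν n (torusIncl ζ) * conj (phi r ν n (torusIncl ζ)) =
      phiStar r ν n (torusIncl ζ) * conj (phiStar r ν n (torusIncl ζ)) := by
    rw [hs, map_mul, Complex.conj_conj]
    linear_combination (-(phi r ν n (torusIncl ζ) * conj (phi r ν n (torusIncl ζ)))) * hZ
  -- Reversal makes the unimodular monomial a common factor of the determinant identity, and it
  -- cancels.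
  have hkey : conj (upperRight r ν n (torusIncl ζ)) * phiStar r ν n (torusIncl ζ) +
      upperRight r ν n (torusIncl ζ) * conj (phiStar r ν n (torusIncl ζ)) = 2 * weight r n := by
    have hZ0 : allocMonomial ν n (torusIncl ζ) ≠ 0 := left_ne_zero_of_mul (hZ ▸ one_ne_zero)
    refine mul_left_cancel₀ hZ0 ?_
    rw [hu, hp] at hdet
    linear_combination hdet
  rw [hnorm, Complex.re_eq_add_conj, carath, map_div₀]
  field_simp
  linear_combination hkey

theorem carath_re_nonneg_on_torus (hr : ∀ n, ‖(r n : ℂ)‖ < 1) (n : ℕ) (ζ : Torus d) :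
    0 ≤ (carath r ν n (torusIncl ζ)).re := by
  have h := carath_re_on_torus ν hr n ζ
  rw [Complex.mul_conj] at h
  rw [show (carath r ν n (torusIncl ζ)).re = weight r n / Complex.normSq (phi r ν n (torusIncl ζ))
    by exact_mod_cast h]
  exact div_nonneg (weight_pos hr n).le (Complex.normSq_nonneg _)

end

/-! ### The measures of the convergents -/

section

variable {d : ℕ} {r : ℕ → Complex.UnitClosedDisc} (ν : ℕ → Fin d)

theorem continuous_carath_re (hr : ∀ n, ‖(r n : ℂ)‖ < 1) (n : ℕ) :
    Continuous fun ζ : Torus d => (carath r ν n (torusIncl ζ)).re :=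
  Complex.continuous_re.comp
    (continuous_comp_torusIncl fun _ hz => differentiableAt_carath ν hr n hz)

theorem carath_at_zero (n : ℕ) : carath r ν n (0 : Fin d → ℂ) = 1 := by
  rw [carath, upperRight_at_zero, phiStar_at_zero, div_one]

/-- The real part of the Carathéodory function of a convergent is the Poisson integral of its
boundary values. -/
theorem integral_carath_re_mul_poissonKernel (hr : ∀ n, ‖(r n : ℂ)‖ < 1) (n : ℕ)
    (z : Polydisc d) :
    ∫ ζ, (carath r ν n (torusIncl ζ)).re * poissonKernel z ζ ∂torusHaar d =
      (carath r ν n z.1).re := by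
  have hd : ∀ z : Fin d → ℂ, (∀ j, ‖z j‖ ≤ 1) → DifferentiableAt ℂ (carath r ν n) z :=
    fun _ hz => differentiableAt_carath ν hr n hz
  rw [← integral_poissonKernel_mul hd z]
  have hint : Integrable (fun ζ => (poissonKernel z ζ : ℂ) * carath r ν n (torusIncl ζ))
      (torusHaar d) := integrable_of_continuous ((Complex.continuous_ofReal.comp
        (continuous_poissonKernel continuous_const continuous_id)).mul
          (continuous_comp_torusIncl hd))
  have := integral_re hint
  simp only [RCLike.re_to_complex] at this
  rw [← this]
  refine integral_congr_ae (.of_forall fun ζ => ?_)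
  simp [mul_comm]

theorem integral_carath_re (hr : ∀ n, ‖(r n : ℂ)‖ < 1) (n : ℕ) :
    ∫ ζ, (carath r ν n (torusIncl ζ)).re ∂torusHaar d = 1 := by
  have h := integral_carath_re_mul_poissonKernel ν hr n (origin d)
  simpa [poissonKernel, origin, Circle.norm_coe, carath_at_zero] using h

/-- The measure with density `Re ((1 + f_n) / (1 - f_n))` on the torus. -/
def convergentMeasure (hr : ∀ n, ‖(r n : ℂ)‖ < 1) (n : ℕ) : ProbabilityMeasure (Torus d) :=
  ⟨(torusHaar d).withDensity fun ζ => ENNReal.ofReal (carath r ν n (torusIncl ζ)).re, by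
    constructor
    rw [withDensity_apply _ MeasurableSet.univ, Measure.restrict_univ,
      ← ofReal_integral_eq_lintegral_ofReal
        (integrable_of_continuous (continuous_carath_re ν hr n))
        (.of_forall (carath_re_nonneg_on_torus ν hr n)), integral_carath_re ν hr n,
      ENNReal.ofReal_one]⟩

theorem integral_convergentMeasure {E : Type*} [NormedAddCommGroup E] [NormedSpace ℝ E]
    (hr : ∀ n, ‖(r n : ℂ)‖ < 1) (n : ℕ) (g : Torus d → E) :
    ∫ ζ, g ζ ∂(convergentMeasure ν hr n : Measure (Torus d)) =
      ∫ ζ, (carath r ν n (torusIncl ζ)).re • g ζ ∂torusHaar d := by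
  change ∫ ζ, g ζ ∂((torusHaar d).withDensity _) = _
  rw [integral_withDensity_eq_integral_toReal_smul
    (continuous_carath_re ν hr n).measurable.ennreal_ofReal
    (.of_forall fun _ => ENNReal.ofReal_lt_top)]
  simp only [ENNReal.toReal_ofReal (carath_re_nonneg_on_torus ν hr n _)]

/-- The columns of `P_n` are the coefficients of the Möbius map from `h` to the Cayley transform.
The form is cross-multiplied since no denominator is yet known to be nonzero; `r_0 = 0` makes
`𝔤_{r_0}` the identity, matching `M_0`. -/
theorem convergentOp_mobius (hr : ∀ n, ‖(r n : ℂ)‖ < 1) (hr0 : (r 0 : ℂ) = 0) (z : Polydisc d)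
    (n : ℕ) (h : HolSpace d) :
    (1 + (convergentOp r ν n h).1 z) * (phiStar r ν n z.1 - phi r ν n z.1 * h.1 z) =
      (1 - (convergentOp r ν n h).1 z) *
        (upperRight r ν n z.1 + upperLeft r ν n z.1 * h.1 z) := by
  induction n generalizing h with
  | zero =>
    have : (convergentOp r ν 0 h).1 z = h.1 z := by
      change discMap (r 0 : ℂ) (h.1 z) = h.1 z
      simp [discMap, hr0]
    rw [this, upperLeft_zero, upperRight_zero, phi_zero, phiStar_zero]
    ring
  | succ n ih =>
    have hden := one_add_conj_mul_ne_zero (hr (n + 1)) (h.2.2 z)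
    have h1 := ih (mOp (ν (n + 1)) (gOp (r (n + 1)) h))
    have hx : (mOp (ν (n + 1)) (gOp (r (n + 1)) h)).1 z * (1 + conj (r (n + 1) : ℂ) * h.1 z) =
        z.1 (ν (n + 1)) * (h.1 z + (r (n + 1) : ℂ)) := by
      change z.1 (ν (n + 1)) * discMap (r (n + 1) : ℂ) (h.1 z) * _ = _
      rw [discMap, if_pos (hr (n + 1)), mul_assoc, div_mul_cancel₀ _ hden]
    change (1 + (convergentOp r ν n (mOp (ν (n + 1)) (gOp (r (n + 1)) h))).1 z) * _ =
      (1 - (convergentOp r ν n (mOp (ν (n + 1)) (gOp (r (n + 1)) h))).1 z) * _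
    set F := (convergentOp r ν n (mOp (ν (n + 1)) (gOp (r (n + 1)) h))).1 z
    rw [upperLeft_succ, upperRight_succ, phi_succ, phiStar_succ]
    linear_combination (1 + conj (r (n + 1) : ℂ) * h.1 z) * h1 +
      ((1 + F) * phi r ν n z.1 + (1 - F) * upperLeft r ν n z.1) * hx

theorem carath_eq (hr : ∀ n, ‖(r n : ℂ)‖ < 1) (hr0 : (r 0 : ℂ) = 0) (z : Polydisc d) (n : ℕ) :
    (1 + (convergent r ν n).1 z) / (1 - (convergent r ν n).1 z) = carath r ν n z.1 := by
  have h := convergentOp_mobius ν hr hr0 z n (constFun d 0)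
  have h0 : (constFun d 0).1 z = 0 := rfl
  have hs := phiStar_ne_zero ν hr n fun j => (z.2 j).le
  rw [h0, mul_zero, mul_zero, sub_zero, add_zero] at h
  change (1 + (convergent r ν n).1 z) * _ = (1 - (convergent r ν n).1 z) * _ at h
  -- If the convergent took the value `1`, the identity would force `2 Φ_n^* = 0`.
  have hne : 1 - (convergent r ν n).1 z ≠ 0 := by
    intro h1
    rw [h1, zero_mul, ← sub_eq_zero.mp h1] at h
    exact mul_ne_zero (by norm_num) hs h
  rw [carath, div_eq_div_iff hne hs, h, mul_comm]

theorem isDeterminedBy_convergent (hr : ∀ n, ‖(r n : ℂ)‖ < 1) (hr0 : (r 0 : ℂ) = 0) (n : ℕ) :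
    IsDeterminedBy (convergentMeasure ν hr n) (convergent r ν n) := by
  intro z
  rw [integral_convergentMeasure, carath_eq ν hr hr0]
  exact (integral_carath_re_mul_poissonKernel ν hr n z).symm

/-! ### Convergence of the continued fraction -/

/-- The maps `discMap r` preserve the pseudo-hyperbolic distance. -/
theorem discMap_pseudoHyperbolic {r a b : ℂ} {q : ℝ} (hr : ‖r‖ < 1) (ha : ‖a‖ ≤ 1) (hb : ‖b‖ ≤ 1)
    (h : ‖a - b‖ ≤ q * ‖1 - conj a * b‖) :
    ‖discMap r a - discMap r b‖ ≤ q * ‖1 - conj (discMap r a) * discMap r b‖ := by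
  have hda := one_add_conj_mul_ne_zero hr ha
  have hdb := one_add_conj_mul_ne_zero hr hb
  have hda' : conj (1 + conj r * a) ≠ 0 := (map_ne_zero _).mpr hda
  have h1 : discMap r a - discMap r b =
      (1 - conj r * r) * (a - b) / ((1 + conj r * a) * (1 + conj r * b)) := by
    rw [discMap, discMap, if_pos hr, if_pos hr, div_sub_div _ _ hda hdb]
    congr 1
    ring
  have h2 : 1 - conj (discMap r a) * discMap r b =
      (1 - conj r * r) * (1 - conj a * b) / (conj (1 + conj r * a) * (1 + conj r * b)) := by
    rw [discMap, discMap, if_pos hr, if_pos hr, map_div₀, div_mul_div_comm,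
      eq_div_iff (mul_ne_zero hda' hdb), sub_mul, div_mul_cancel₀ _ (mul_ne_zero hda' hdb)]
    simp only [map_add, map_mul, map_one, Complex.conj_conj]
    ring
  rw [h1, h2, norm_div, norm_div, norm_mul, norm_mul, norm_mul, norm_mul, RCLike.norm_conj,
    ← mul_div_assoc, mul_left_comm]
  gcongr

theorem norm_one_sub_mul_le {t : ℝ} (ht0 : 0 ≤ t) (ht : t ≤ 1) {u : ℂ} (hu : ‖u‖ ≤ 1) :
    (1 + t) * ‖1 - u‖ ≤ 2 * ‖1 - t * u‖ := by
  refine le_of_sq_le_sq ?_ (by positivity)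
  rw [mul_pow, mul_pow, ← Complex.normSq_eq_norm_sq, ← Complex.normSq_eq_norm_sq]
  have hre : -‖u‖ ≤ u.re := (abs_le.mp (Complex.abs_re_le_norm u)).1
  have hsq : ‖u‖ ^ 2 = u.re * u.re + u.im * u.im := by
    rw [← Complex.normSq_eq_norm_sq, Complex.normSq_apply]
  have hn := norm_nonneg u
  simp only [Complex.normSq_apply, Complex.sub_re, Complex.sub_im, Complex.one_re, Complex.one_im,
    Complex.re_ofReal_mul, Complex.im_ofReal_mul]
  -- This product is the difference of the squared sides. Its second factor is bounded below by
  -- inserting `Re u ≥ -‖u‖`, after which it splits off `1 - ‖u‖`; equality holds at `u = -1`.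
  have hkey : 0 ≤ (1 - t) * (3 + t + 2 * (1 - t) * u.re - ‖u‖ ^ 2 * (1 + 3 * t)) := by
    refine mul_nonneg (by linarith) ?_
    have h1 : (1 - t) * -‖u‖ ≤ (1 - t) * u.re := mul_le_mul_of_nonneg_left hre (by linarith)
    have h2 : 0 ≤ (1 - ‖u‖) * (3 + t + (1 + 3 * t) * ‖u‖) :=
      mul_nonneg (by linarith) (by positivity)
    linarith
  rw [hsq] at hkey
  linarith

/-- Multiplication by a number of modulus at most `s < 1` contracts the pseudo-hyperbolic
distance. -/
theorem mul_pseudoHyperbolic {z x y : ℂ} {s q : ℝ} (hz : ‖z‖ ≤ s) (hs : s ≤ 1)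
    (hx : ‖x‖ ≤ 1) (hy : ‖y‖ ≤ 1) (hq : 0 ≤ q) (h : ‖x - y‖ ≤ q * ‖1 - conj x * y‖) :
    ‖z * x - z * y‖ ≤ q * (2 * s / (1 + s ^ 2)) * ‖1 - conj (z * x) * (z * y)‖ := by
  have hz0 := norm_nonneg z
  have hu : ‖conj x * y‖ ≤ 1 := by
    rw [norm_mul, RCLike.norm_conj]
    exact mul_le_one₀ hx (norm_nonneg _) hy
  have hk := norm_one_sub_mul_le (sq_nonneg ‖z‖) (by nlinarith) hu
  have he : conj (z * x) * (z * y) = ((‖z‖ ^ 2 : ℝ) : ℂ) * (conj x * y) := by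
    push_cast
    rw [map_mul, ← Complex.conj_mul']
    ring
  -- The factor is the pseudo-hyperbolic distance of `s` and `-s`, the extremal case of antipodal
  -- `x` and `y` on the circle. It increases with `s` on `[0, 1]`.
  have hmono : 2 * ‖z‖ / (1 + ‖z‖ ^ 2) ≤ 2 * s / (1 + s ^ 2) := by
    rw [div_le_div_iff₀ (by positivity) (by positivity)]
    have : 0 ≤ (s - ‖z‖) * (1 - s * ‖z‖) :=
      mul_nonneg (by linarith) (by nlinarith)
    nlinarith
  rw [← mul_sub, norm_mul, he]
  calc ‖z‖ * ‖x - y‖ ≤ ‖z‖ * (q * ‖1 - conj x * y‖) := by gcongr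
    _ = q * ‖z‖ / (1 + ‖z‖ ^ 2) * ((1 + ‖z‖ ^ 2) * ‖1 - conj x * y‖) := by
      field_simp
    _ ≤ q * ‖z‖ / (1 + ‖z‖ ^ 2) *
        (2 * ‖1 - ((‖z‖ ^ 2 : ℝ) : ℂ) * (conj x * y)‖) := by gcongr
    _ = q * (2 * ‖z‖ / (1 + ‖z‖ ^ 2)) * ‖1 - ((‖z‖ ^ 2 : ℝ) : ℂ) * (conj x * y)‖ := by ring
    _ ≤ _ := by gcongr

theorem convergentOp_pseudoHyperbolic (hr : ∀ n, ‖(r n : ℂ)‖ < 1) (z : Polydisc d) {s : ℝ}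
    (hz : ∀ j, ‖z.1 j‖ ≤ s) (hs0 : 0 ≤ s) (hs : s ≤ 1) (n : ℕ) (a b : HolSpace d) {q : ℝ}
    (hq : 0 ≤ q) (h : ‖a.1 z - b.1 z‖ ≤ q * ‖1 - conj (a.1 z) * b.1 z‖) :
    ‖(convergentOp r ν n a).1 z - (convergentOp r ν n b).1 z‖ ≤
      q * (2 * s / (1 + s ^ 2)) ^ n *
        ‖1 - conj ((convergentOp r ν n a).1 z) * (convergentOp r ν n b).1 z‖ := by
  induction n generalizing a b q with
  | zero =>
    rw [pow_zero, mul_one]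
    exact discMap_pseudoHyperbolic (hr 0) (a.2.2 z) (b.2.2 z) h
  | succ n ih =>
    have h1 := discMap_pseudoHyperbolic (hr (n + 1)) (a.2.2 z) (b.2.2 z) h
    have h2 := mul_pseudoHyperbolic (hz (ν (n + 1))) hs ((gOp (r (n + 1)) a).2.2 z)
      ((gOp (r (n + 1)) b).2.2 z) hq h1
    have h3 := ih (mOp (ν (n + 1)) (gOp (r (n + 1)) a)) (mOp (ν (n + 1)) (gOp (r (n + 1)) b))
      (by positivity) h2
    rwa [mul_assoc q, ← pow_succ'] at h3

theorem IsExpansion.eq_convergentOp [NeZero d] {f : HolSpace d} {ν : ℕ → Fin d}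
    {h : ℕ → HolSpace d} (hexp : IsExpansion f r ν h) (n : ℕ) :
    f = convergentOp r ν n (mOp (ν (n + 1)) (h (n + 1))) := by
  induction n with
  | zero => rw [← hexp.start]; exact hexp.step 0
  | succ n ih =>
    rw [ih, hexp.step (n + 1)]
    rfl

/-- Both `f_n` and `f` are images under the same operator, of `0` and of a remainder at
pseudo-hyperbolic distance at most one. The `n` coordinate factors make the distance decay
geometrically; the constant `2` bounds `‖1 - conj a * b‖`. -/
theorem IsExpansion.tendsto_convergent [NeZero d] {f : HolSpace d} {ν : ℕ → Fin d}
    {h : ℕ → HolSpace d} (hexp : IsExpansion f r ν h) (hr : ∀ n, ‖(r n : ℂ)‖ < 1)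
    (z : Polydisc d) : Tendsto (fun n => (convergent r ν n).1 z) atTop (𝓝 (f.1 z)) := by
  have hs : ‖z.1‖ < 1 := (pi_norm_lt_iff one_pos).mpr z.2
  have hs0 := norm_nonneg z.1
  have hc : 2 * ‖z.1‖ / (1 + ‖z.1‖ ^ 2) < 1 := by
    rw [div_lt_one (by positivity)]
    nlinarith [sq_pos_of_pos (sub_pos.mpr hs)]
  have hbound : ∀ n, ‖(convergent r ν n).1 z - f.1 z‖ ≤
      2 * (2 * ‖z.1‖ / (1 + ‖z.1‖ ^ 2)) ^ n := by
    intro n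
    have h0 : (constFun d 0).1 z = 0 := rfl
    have h1 := convergentOp_pseudoHyperbolic ν hr z (norm_le_pi_norm z.1) hs0 hs.le n
      (constFun d 0) (mOp (ν (n + 1)) (h (n + 1))) zero_le_one (by
        rw [h0]
        simpa using (mOp (ν (n + 1)) (h (n + 1))).2.2 z)
    rw [← hexp.eq_convergentOp n, one_mul, mul_comm] at h1
    refine h1.trans (mul_le_mul_of_nonneg_right ?_ (by positivity))
    refine (norm_sub_le _ _).trans ?_
    rw [norm_one, norm_mul, RCLike.norm_conj]
    linarith [mul_le_one₀ ((convergentOp r ν n (constFun d 0)).2.2 z) (norm_nonneg _) (f.2.2 z)]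
  rw [tendsto_iff_norm_sub_tendsto_zero]
  refine squeeze_zero (fun _ => norm_nonneg _) hbound ?_
  simpa using (tendsto_pow_atTop_nhds_zero_of_lt_one (by positivity) hc).const_mul 2

theorem IsExpansion.ne_one [NeZero d] {f : HolSpace d} {ν : ℕ → Fin d}
    {h : ℕ → HolSpace d} (hexp : IsExpansion f r ν h) (hr0 : (r 0 : ℂ) = 0) (z : Polydisc d) :
    f.1 z ≠ 1 := by
  intro h1
  have hf : f.1 z = z.1 (ν 1) * (h 1).1 z := by
    rw [hexp.eq_convergentOp 0]
    change discMap (r 0 : ℂ) _ = _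
    simp only [discMap, hr0]
    simp
    rfl
  have hlt : ‖f.1 z‖ < 1 := by
    rw [hf, norm_mul]
    exact (mul_le_of_le_one_right (norm_nonneg _) ((h 1).2.2 z)).trans_lt (z.2 _)
  rw [h1, norm_one] at hlt
  exact lt_irrefl _ hlt

/-! ### Orthogonality -/

/-- The monomial `z_{ν_{k+1}} ⋯ z_{ν_n}`. -/
def allocTail (k n : ℕ) (z : Fin d → ℂ) : ℂ := ∏ s ∈ Finset.Ico k n, z (ν (s + 1))

theorem allocMonomial_mul_allocTail {k n : ℕ} (hkn : k ≤ n) (z : Fin d → ℂ) :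
    allocMonomial ν k z * allocTail ν k n z = allocMonomial ν n z :=
  Finset.prod_range_mul_prod_Ico _ hkn

theorem allocTail_at_zero {k n : ℕ} (hkn : k < n) : allocTail ν k n (0 : Fin d → ℂ) = 0 :=
  Finset.prod_eq_zero (Finset.left_mem_Ico.mpr hkn) rfl

theorem allocTail_self (k : ℕ) (z : Fin d → ℂ) : allocTail ν k k z = 1 := by
  simp [allocTail]

theorem differentiable_prod_apply {ι : Type*} (s : Finset ι) (m : ι → Fin d) :
    Differentiable ℂ fun z : Fin d → ℂ => ∏ i ∈ s, z (m i) := by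
  classical
  induction s using Finset.induction_on with
  | empty => simp
  | insert a s ha ih =>
    simp only [Finset.prod_insert ha]
    exact (differentiable_apply (m a)).mul ih

theorem differentiable_allocTail (k n : ℕ) : Differentiable ℂ (allocTail ν k n) :=
  differentiable_prod_apply _ _

theorem differentiable_allocMonomial (n : ℕ) : Differentiable ℂ (allocMonomial ν n) :=
  differentiable_prod_apply _ _

theorem allocTail_mul_conj (k n : ℕ) (ζ : Torus d) :
    allocTail ν k n (torusIncl ζ) * conj (allocTail ν k n (torusIncl ζ)) = 1 := by
  simp [allocTail, ← Finset.prod_mul_distrib, torusIncl_mul_conj]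

/-- The first `k` factors of the monomial turn `conj Φ_k` into `Φ_k^*`. The integrand is then
holomorphic, and a remaining coordinate factor makes it vanish at the origin. -/
theorem integral_phi_mul_conj_phi_mul_allocMonomial {j k n : ℕ} (hkn : k < n)
    {G : (Fin d → ℂ) → ℂ} (hG : ∀ z, (∀ j, ‖z j‖ ≤ 1) → DifferentiableAt ℂ G z) :
    ∫ ζ, phi r ν j (torusIncl ζ) * conj (phi r ν k (torusIncl ζ)) *
      (allocMonomial ν n (torusIncl ζ) * G (torusIncl ζ)) ∂torusHaar d = 0 := by
  have h := integral_torusHaar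
    (G := fun z => phi r ν j z * phiStar r ν k z * (allocTail ν k n z * G z))
    fun z hz => ((differentiable_phi r ν j z).mul (differentiable_phiStar r ν k z)).mul
      ((differentiable_allocTail ν k n z).mul (hG z hz))
  rw [allocTail_at_zero ν hkn, zero_mul, mul_zero] at h
  rw [← h]
  refine integral_congr_ae (.of_forall fun ζ => ?_)
  simp only
  rw [(phi_eq_on_torus r ν k ζ).2, ← allocMonomial_mul_allocTail ν hkn.le]
  ring

/-- The inner product of `Φ_j` and `Φ_k` with respect to the measure of the `n`-th convergent. -/
def phiInner (r : ℕ → Complex.UnitClosedDisc) (ν : ℕ → Fin d) (n j k : ℕ) : ℂ :=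
  ∫ ζ, phi r ν j (torusIncl ζ) * conj (phi r ν k (torusIncl ζ)) *
    ((carath r ν n (torusIncl ζ)).re : ℂ) ∂torusHaar d

theorem conj_phiInner (n j k : ℕ) : conj (phiInner r ν n j k) = phiInner r ν n k j := by
  rw [phiInner, phiInner, ← integral_conj]
  refine integral_congr_ae (.of_forall fun ζ => ?_)
  simp only [map_mul, Complex.conj_conj, Complex.conj_ofReal]
  ring

/-- Against the density `weight r n / |Φ_n|²` the integrand is `weight r n * Φ_j / Φ_n`. By reversal
this is the conjugate of a holomorphic function that vanishes at the origin unless `j = n`. -/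
theorem phiInner_self_right (hr : ∀ n, ‖(r n : ℂ)‖ < 1) {j n : ℕ} (hjn : j ≤ n) :
    phiInner r ν n j n = if j = n then (weight r n : ℂ) else 0 := by
  have h := integral_torusHaar (G := fun z => weight r n * (allocTail ν j n z *
      (phiStar r ν j z * (phiStar r ν n z)⁻¹)))
    fun z hz => (((differentiable_allocTail ν j n z).mul ((differentiable_phiStar r ν j z).mul
      ((differentiable_phiStar r ν n z).inv (phiStar_ne_zero ν hr n hz)))).const_mul _)
  have h' := congrArg conj h
  rw [← integral_conj] at h'
  have hz : conj ((weight r n : ℂ) * (allocTail ν j n (0 : Fin d → ℂ) *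
      (phiStar r ν j (0 : Fin d → ℂ) * (phiStar r ν n (0 : Fin d → ℂ))⁻¹))) =
      if j = n then (weight r n : ℂ) else 0 := by
    split_ifs with hj
    · subst hj
      simp [allocTail_self, phiStar_at_zero]
    · simp [allocTail_at_zero ν (lt_of_le_of_ne hjn hj)]
  rw [← hz, ← h', phiInner]
  refine integral_congr_ae (.of_forall fun ζ => ?_)
  simp only [map_mul, map_inv₀, Complex.conj_ofReal]
  have hp := phi_ne_zero_on_torus ν hr n ζ
  have hp' : conj (phi r ν n (torusIncl ζ)) ≠ 0 := (map_ne_zero _).mpr hp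
  have hs : conj (phiStar r ν n (torusIncl ζ)) ≠ 0 :=
    (map_ne_zero _).mpr (phiStar_ne_zero ν hr n (norm_torusIncl_le ζ))
  have hkey : phi r ν j (torusIncl ζ) * conj (phiStar r ν n (torusIncl ζ)) =
      conj (allocTail ν j n (torusIncl ζ)) * conj (phiStar r ν j (torusIncl ζ)) *
        phi r ν n (torusIncl ζ) := by
    rw [(phi_eq_on_torus r ν n ζ).1, (phi_eq_on_torus r ν j ζ).1,
      ← allocMonomial_mul_allocTail ν hjn]
    linear_combination (-(allocMonomial ν j (torusIncl ζ) * conj (phiStar r ν j (torusIncl ζ)) *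
      conj (phiStar r ν n (torusIncl ζ)))) * allocTail_mul_conj ν j n ζ
  rw [carath_re_on_torus ν hr]
  field_simp
  linear_combination (weight r n : ℂ) * hkey

theorem phiInner_succ (hr : ∀ n, ‖(r n : ℂ)‖ < 1) {n j k : ℕ} (hj : j ≤ n) (hk : k ≤ n) :
    phiInner r ν (n + 1) j k = phiInner r ν n j k := by
  set G : (Fin d → ℂ) → ℂ := fun z => ((r (n + 1) : ℂ) * weight r n) *
    ((phiStar r ν (n + 1) z)⁻¹ * (phiStar r ν n z)⁻¹) with hGdef
  have hG : ∀ z : Fin d → ℂ, (∀ j, ‖z j‖ ≤ 1) → DifferentiableAt ℂ G z := fun z hz =>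
    (((differentiable_phiStar r ν (n + 1) z).inv (phiStar_ne_zero ν hr _ hz)).mul
      ((differentiable_phiStar r ν n z).inv (phiStar_ne_zero ν hr _ hz))).const_mul _
  have hA := integral_phi_mul_conj_phi_mul_allocMonomial (r := r) ν (j := j)
    (Nat.lt_succ_of_le hk) hG
  -- The real part also contributes the conjugate of the increment; conjugation exchanges `j` and
  -- `k`, which is why both must be at most `n`.
  have hB := congrArg conj (integral_phi_mul_conj_phi_mul_allocMonomial (r := r) ν (j := k)
    (Nat.lt_succ_of_le hj) hG)
  rw [← integral_conj, map_zero] at hB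
  have hcont : ∀ F : (Fin d → ℂ) → ℂ, Differentiable ℂ F →
      Continuous fun ζ : Torus d => F (torusIncl ζ) := fun F hF =>
    continuous_comp_torusIncl fun z _ => hF z
  have hphi := fun m => hcont _ (differentiable_phi r ν m)
  have hZ : Continuous fun ζ : Torus d => allocMonomial ν (n + 1) (torusIncl ζ) :=
    hcont _ (differentiable_allocMonomial ν (n + 1))
  have hGc := continuous_comp_torusIncl hG
  have hpair : ∀ a b, Continuous fun ζ : Torus d =>
      phi r ν a (torusIncl ζ) * conj (phi r ν b (torusIncl ζ)) := fun a b =>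
    (hphi a).mul (Complex.continuous_conj.comp (hphi b))
  have hre : ∀ m, Integrable (fun ζ => phi r ν j (torusIncl ζ) * conj (phi r ν k (torusIncl ζ)) *
      ((carath r ν m (torusIncl ζ)).re : ℂ)) (torusHaar d) := fun m => integrable_of_continuous
    ((hpair j k).mul (Complex.continuous_ofReal.comp (continuous_carath_re ν hr m)))
  have hI : ∀ a b, Continuous fun ζ : Torus d =>
      phi r ν a (torusIncl ζ) * conj (phi r ν b (torusIncl ζ)) *
        (allocMonomial ν (n + 1) (torusIncl ζ) * G (torusIncl ζ)) := fun a b =>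
    (hpair a b).mul (hZ.mul hGc)
  have hI' : Continuous fun ζ : Torus d =>
      conj (phi r ν k (torusIncl ζ) * conj (phi r ν j (torusIncl ζ)) *
        (allocMonomial ν (n + 1) (torusIncl ζ) * G (torusIncl ζ))) :=
    Complex.continuous_conj.comp (hI k j)
  rw [← sub_eq_zero, phiInner, phiInner, ← integral_sub (hre _) (hre _)]
  have hAB := integral_add (μ := torusHaar d) (integrable_of_continuous (hI j k))
    (integrable_of_continuous hI')
  rw [hA, hB, add_zero] at hAB
  rw [← hAB]
  refine integral_congr_ae (.of_forall fun ζ => ?_)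
  have h0 := phiStar_ne_zero ν hr n (norm_torusIncl_le ζ)
  have h1 := phiStar_ne_zero ν hr (n + 1) (norm_torusIncl_le ζ)
  have hdiff : carath r ν (n + 1) (torusIncl ζ) - carath r ν n (torusIncl ζ) =
      2 * (allocMonomial ν (n + 1) (torusIncl ζ) * G (torusIncl ζ)) := by
    rw [carath, carath, div_sub_div _ _ h1 h0, mul_comm (phiStar r ν (n + 1) _) (upperRight r ν n _),
      upperRight_mul_phiStar_sub, hGdef]
    field_simp
  have hc := congrArg conj hdiff
  simp only [map_sub, map_mul, map_ofNat] at hc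
  simp only [Complex.re_eq_add_conj, map_mul, Complex.conj_conj]
  linear_combination (phi r ν j (torusIncl ζ) * conj (phi r ν k (torusIncl ζ)) / 2) * (hdiff + hc)

/-- The pairing is constant for `n ≥ max j k`, and at `n = max j k` one of the two polynomials is
`Φ_n`. -/
theorem phiInner_eq (hr : ∀ n, ‖(r n : ℂ)‖ < 1) {n j k : ℕ} (hj : j ≤ n) (hk : k ≤ n) :
    phiInner r ν n j k = if j = k then (weight r j : ℂ) else 0 := by
  induction n, max_le hj hk using Nat.le_induction with
  | base =>
    rcases le_total j k with h | h
    · rw [max_eq_right h, phiInner_self_right ν hr h]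
      split_ifs with h' <;> simp [h']
    · rw [max_eq_left h, ← conj_phiInner, phiInner_self_right ν hr h]
      simp only [eq_comm (a := k)]
      split_ifs <;> simp
  | succ n hn ih =>
    have hj' := (le_max_left _ _).trans hn
    have hk' := (le_max_right _ _).trans hn
    rw [phiInner_succ ν hr hj' hk', ih hj' hk']

theorem integral_torusEval_convergentMeasure (hr : ∀ n, ‖(r n : ℂ)‖ < 1) {n j k : ℕ}
    (hj : j ≤ n) (hk : k ≤ n) :
    ∫ ζ, torusEval (orthoPoly r ν j) ζ * conj (torusEval (orthoPoly r ν k) ζ)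
      ∂(convergentMeasure ν hr n : Measure (Torus d)) =
      if j = k then (weight r j : ℂ) else 0 := by
  rw [integral_convergentMeasure, ← phiInner_eq ν hr hj hk, phiInner]
  refine integral_congr_ae (.of_forall fun ζ => ?_)
  simp only [Complex.real_smul]
  rw [mul_comm]
  rfl

theorem continuous_torusEval (p : MvPolynomial (Fin d) ℂ) :
    Continuous (torusEval p : Torus d → ℂ) :=
  (MvPolynomial.continuous_eval p).comp continuous_torusIncl

end

end SchurTorus

end

open SchurTorus
-- Passage to the limit
theorem mainTheorem6 (d : ℕ) [NeZero d] (f : HolSpace d) (hf : IsStandard f)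
    (r : ℕ → Complex.UnitClosedDisc) (ν : ℕ → Fin d) (h : ℕ → HolSpace d)
    (hexp : IsExpansion f r ν h) :
    (∃! μ : ProbabilityMeasure (Torus d), IsDeterminedBy μ f) ∧
    (∀ n : ℕ, ∃! μ : ProbabilityMeasure (Torus d), IsDeterminedBy μ (convergent r ν n)) ∧
    Tendsto (fun n : ℕ => schurMeasure (convergent r ν n)) atTop (𝓝 (schurMeasure f)) ∧
    ∀ j k : ℕ,
      ∫ ζ, torusEval (orthoPoly r ν j) ζ * conj (torusEval (orthoPoly r ν k) ζ)
          ∂(schurMeasure f : Measure (Torus d)) =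
        if j = k then ((∏ s ∈ Finset.Icc 1 j, (1 - ‖(r s : ℂ)‖ ^ 2) : ℝ) : ℂ) else 0 := by
  have hr : ∀ n, ‖(r n : ℂ)‖ < 1 := hf.2.2 r ν h hexp
  have hr0 : (r 0 : ℂ) = 0 := by rw [hexp.param 0, hexp.start, hf.2.1]
  have hconv := isDeterminedBy_convergent ν hr hr0
  obtain ⟨μ, hμ, hlim⟩ := exists_isDeterminedBy_of_tendsto hconv (hexp.tendsto_convergent hr)
    (hexp.ne_one hr0)
  refine ⟨⟨μ, hμ, fun _ h' => h'.unique hμ⟩, fun n => ⟨_, hconv n, fun _ h' => h'.unique (hconv n)⟩,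
    ?_, fun j k => ?_⟩
  · simpa only [hμ.schurMeasure_eq, (hconv _).schurMeasure_eq] using hlim
  · rw [hμ.schurMeasure_eq]
    have hg : Continuous fun ζ : Torus d =>
        torusEval (orthoPoly r ν j) ζ * conj (torusEval (orthoPoly r ν k) ζ) :=
      (continuous_torusEval _).mul (Complex.continuous_conj.comp (continuous_torusEval _))
    -- The integrand is continuous, so weak convergence applies; along the convergents the integrals
    -- are constant from `max j k` on.
    refine tendsto_nhds_unique
      ((ProbabilityMeasure.tendsto_iff_forall_integral_rclike_tendsto ℂ).mp hlim
        (BoundedContinuousFunction.mkOfCompact ⟨_, hg⟩)) (tendsto_const_nhds.congr' ?_)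
    filter_upwards [eventually_ge_atTop (max j k)] with n hn
    exact (integral_torusEval_convergentMeasure ν hr ((le_max_left _ _).trans hn)
      ((le_max_right _ _).trans hn)).symm
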